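/- All graphs are finite, simple and undirected. For a vertex $v$ of a graph $G$, let $N[v]$ denote the closed neighbourhood of $v$, that is, $v$ together with all its neighbours. The graph $G$ is twin-free if $N[u]\neq N[v]$ for any two distinct vertices $u,v$. An identifying code of $G$ is a set $\mathcal C$ of vertices such that every vertex outside $\mathcal C$ has a neighbour in $\mathcal C$ and $N[u]\cap\mathcal C\neq N[v]\cap\mathcal C$ for any two distinct vertices $u,v$. The minimum size of an identifying code of $G$ is denoted by $\gamma^{\mathrm{ID}}(G)$ (in a twin-free graph the set of all vertices is an identifying code, so this minimum exists). A vertex $w$ is forced if there are vertices $u,v$, with $u,v,w$ pairwise distinct, such that $N[u]\mathbin{\Delta}N[v]=\{w\}$, where $\Delta$ denotes the symmetric difference. Let $f(G)$ be the number of non-forced vertices of $G$ divided by the number of all vertices of $G$. **Theorem.** Let $G$ be a twin-free graph without isolated vertices, on $n$ vertices and of maximum degree $d\geq 3$. Then $$\gamma^{\mathrm{ID}}(G)\;\leq\; n-\frac{n\,f(G)^2}{103\,d}.$$ -/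

import Mathlib

open scoped symmDiff

namespace SimpleGraph

variable {V : Type*} (G : SimpleGraph V)

/-- The closed neighbourhood `N[v]`: the neighbours of `v` together with `v` itself. -/
def closedNbhd (v : V) : Set V := insert v (G.neighborSet v)

/-- No two distinct vertices have the same closed neighbourhood. -/
def IsTwinFree : Prop := ∀ u v : V, u ≠ v → G.closedNbhd u ≠ G.closedNbhd v

/-- Each vertex outside `C` has a neighbour in `C`. -/
def IsDominatingSet (C : Set V) : Prop := ∀ v : V, v ∉ C → ∃ c ∈ C, G.Adj v c

/-- Any two distinct vertices are distinguished by the traces of their closed neighbourhoods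
on `C`. -/
def IsSeparatingSet (C : Set V) : Prop :=
  ∀ u v : V, u ≠ v → G.closedNbhd u ∩ C ≠ G.closedNbhd v ∩ C

/-- An identifying code: a set that is both dominating and separating. -/
def IsIdentifyingCode (C : Set V) : Prop := G.IsDominatingSet C ∧ G.IsSeparatingSet C

/-- The identifying code number: the minimum size of an identifying code. For a finite twin-free
graph the minimum exists, see `IsTwinFree.isLeast_idCodeNumber`; otherwise it is a junk value. -/
noncomputable def idCodeNumber : ℕ :=
  sInf {k : ℕ | ∃ C : Set V, G.IsIdentifyingCode C ∧ C.ncard = k}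

/-- The vertex `w` is forced: there are vertices `u`, `v`, with `u`, `v`, `w` pairwise distinct,
whose closed neighbourhoods differ exactly in `w`. -/
def IsForcedVertex (w : V) : Prop :=
  ∃ u v : V, u ≠ v ∧ u ≠ w ∧ v ≠ w ∧ G.closedNbhd u ∆ G.closedNbhd v = {w}

/-- The proportion `f(G)` of non-forced vertices among all the vertices of `G`. -/
noncomputable def nonForcedProportion : ℝ :=
  ({w : V | ¬ G.IsForcedVertex w}.ncard : ℝ) / (Nat.card V : ℝ)

theorem IsTwinFree.isIdentifyingCode_univ {G : SimpleGraph V} (h : G.IsTwinFree) :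
    G.IsIdentifyingCode Set.univ :=
  ⟨fun v hv => absurd (Set.mem_univ v) hv, fun u v huv => by simpa using h u v huv⟩

theorem IsTwinFree.isLeast_idCodeNumber {G : SimpleGraph V} (h : G.IsTwinFree) :
    IsLeast {k : ℕ | ∃ C : Set V, G.IsIdentifyingCode C ∧ C.ncard = k} G.idCodeNumber :=
  ⟨Nat.sInf_mem ⟨_, Set.univ, h.isIdentifyingCode_univ, rfl⟩, fun _ hk => Nat.sInf_le hk⟩

end SimpleGraph

/-!
The proof is an alteration argument. Let `W` be the set of non-forced vertices. The complement of a
set `S ⊆ W` is an identifying code as soon as `S` contains no closed neighbourhood and no symmetric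
difference `N[u] ∆ N[v]` with `u ≠ v`; call these sets *obstructions*. Obstructions have at least
two elements when they lie in `W`: closed neighbourhoods because there are no isolated vertices,
symmetric differences because the graph is twin-free and a singleton difference consists of a
forced vertex.

Not all pairs `u, v` are needed. If `u` and `v` are non-adjacent without a common neighbour, then
`N[u] ⊆ N[u] ∆ N[v]`. If they are non-adjacent with `|N[u] ∆ N[v]| = 2`, then they have the same
neighbours, so `v` is adjacent to a neighbour of `u` fixed in advance. Hence there are at
most `n + 2nd` obstructions of size at least two coming from closed neighbourhoods, adjacent pairs
and such false twins (`SimpleGraph.smallObstructions`), and at most `n d²` further ones, all of size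
at least three, coming from pairs with a common neighbour (`SimpleGraph.largeObstructions`).

Choose a subset of `W` at random, each vertex independently with probability `p = f / (4d)`, and
delete one vertex from each obstruction contained in it
(`Finset.exists_subset_forall_not_subset`). The expected size of the result is at least
`p f n - p² (n + 2nd) - p³ n d²`, which is at least `n f² / (103 d)`.
-/

/-! ### Independent sets in hypergraphs by alteration -/

namespace Finset

variable {V : Type*} [DecidableEq V]

/-- If each element of `W` is selected independently with probability `p`, then all elements of
`e ⊆ W` are selected with probability `p ^ #e`. -/
theorem sum_powerset_bernoulli_superset (W e : Finset V) (he : e ⊆ W) (p : ℝ) :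
    ∑ S ∈ W.powerset, p ^ #S * (1 - p) ^ #(W \ S) * (if e ⊆ S then 1 else 0) = p ^ #e := by
  have key := prod_add (fun _ : V => p) (fun i => if i ∈ e then 0 else 1 - p) W
  have hl : ∏ i ∈ W, (p + if i ∈ e then 0 else 1 - p) = p ^ #e := by
    have h1 : ∀ i ∈ W, (p + if i ∈ e then 0 else 1 - p) = if i ∈ e then p else 1 := by
      intro i _
      split_ifs <;> ring
    rw [prod_congr rfl h1, prod_ite, prod_const, prod_const_one, mul_one,
      filter_mem_eq_inter, inter_eq_right.mpr he]
  rw [← hl, key]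
  refine sum_congr rfl fun S _ => ?_
  rw [prod_const, mul_assoc]
  congr 1
  split_ifs with h
  · rw [mul_one, ← prod_const]
    refine prod_congr rfl fun i hi => ?_
    rw [if_neg fun hie => (mem_sdiff.mp hi).2 (h hie)]
  · obtain ⟨i, hie, hiS⟩ := not_subset.mp h
    rw [mul_zero]
    symm
    apply prod_eq_zero (mem_sdiff.mpr ⟨he hie, hiS⟩)
    exact if_pos hie

/-- A set of vertices from which one vertex of each edge it contains is deleted. -/
theorem exists_subset_card_add_card_filter (E : Finset (Finset V))
    (hE : ∀ e ∈ E, e.Nonempty) (S : Finset V) :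
    ∃ T ⊆ S, (∀ e ∈ E, ¬ e ⊆ T) ∧ #S ≤ #T + #{e ∈ E | e ⊆ S} := by
  rcases E.eq_empty_or_nonempty with rfl | ⟨e₀, he₀⟩
  · exact ⟨S, Subset.rfl, by simp, by simp⟩
  have : Nonempty V := (hE e₀ he₀).to_type
  choose! x hx using hE
  refine ⟨S \ ({e ∈ E | e ⊆ S}).image x, sdiff_subset, fun e he hsub => ?_, ?_⟩
  · exact (mem_sdiff.mp (hsub (hx e he))).2
      (mem_image_of_mem x (mem_filter.mpr ⟨he, hsub.trans sdiff_subset⟩))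
  · have h1 := le_card_sdiff (({e ∈ E | e ⊆ S}).image x) S
    have h2 : #(({e ∈ E | e ⊆ S}).image x) ≤ #{e ∈ E | e ⊆ S} := card_image_le
    omega

/-- The first-moment bound: a random subset of `W` of density `p` has expected size `p * #W` and
contains `∑ e ∈ E, p ^ #e` edges of `E` or fewer in expectation. -/
theorem exists_subset_forall_not_subset (W : Finset V) (E : Finset (Finset V))
    (hE : ∀ e ∈ E, e.Nonempty) (p : ℝ) (hp0 : 0 ≤ p) (hp1 : p ≤ 1) :
    ∃ S ⊆ W, (∀ e ∈ E, ¬ e ⊆ S) ∧ p * #W - ∑ e ∈ E, p ^ #e ≤ (#S : ℝ) := by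
  set μ : Finset V → ℝ := fun S => p ^ #S * (1 - p) ^ #(W \ S) with hμ
  have hμ0 : ∀ S, 0 ≤ μ S := fun S =>
    mul_nonneg (pow_nonneg hp0 _) (pow_nonneg (sub_nonneg.mpr hp1) _)
  have hμ1 : ∑ S ∈ W.powerset, μ S = 1 := by
    simpa using sum_powerset_bernoulli_superset W ∅ (empty_subset _) p
  have hcard : ∑ S ∈ W.powerset, μ S * (#S : ℝ) = p * #W := by
    have h1 : ∀ S ∈ W.powerset,
        μ S * (#S : ℝ) = ∑ v ∈ W, μ S * (if {v} ⊆ S then 1 else 0) := by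
      intro S hS
      rw [← mul_sum]
      simp only [singleton_subset_iff, sum_boole, filter_mem_eq_inter,
        inter_eq_right.mpr (mem_powerset.mp hS)]
    rw [sum_congr rfl h1, sum_comm, sum_congr rfl fun v hv =>
      sum_powerset_bernoulli_superset W {v} (singleton_subset_iff.mpr hv) p]
    simp [mul_comm]
  have hbad : ∑ S ∈ W.powerset, μ S * (#{e ∈ E | e ⊆ S} : ℝ) ≤ ∑ e ∈ E, p ^ #e := by
    have h1 : ∀ S ∈ W.powerset,
        μ S * (#{e ∈ E | e ⊆ S} : ℝ) = ∑ e ∈ E, μ S * (if e ⊆ S then 1 else 0) := by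
      intro S _
      rw [← mul_sum, sum_boole]
    rw [sum_congr rfl h1, sum_comm]
    refine sum_le_sum fun e _ => ?_
    by_cases heW : e ⊆ W
    · exact (sum_powerset_bernoulli_superset W e heW p).le
    · rw [sum_eq_zero fun S hS => ?_]
      · exact pow_nonneg hp0 _
      · rw [if_neg fun h => heW (h.trans (mem_powerset.mp hS)), mul_zero]
  have hex : ∃ S ∈ W.powerset,
      p * #W - ∑ e ∈ E, p ^ #e ≤ (#S : ℝ) - (#{e ∈ E | e ⊆ S} : ℝ) := by
    by_contra! hlt
    have hle : ∀ S ∈ W.powerset, μ S * ((#S : ℝ) - (#{e ∈ E | e ⊆ S} : ℝ)) ≤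
        μ S * (p * #W - ∑ e ∈ E, p ^ #e) :=
      fun S hS => mul_le_mul_of_nonneg_left (hlt S hS).le (hμ0 S)
    have hpos : ∃ S ∈ W.powerset, μ S ≠ 0 := by
      by_contra! h0
      rw [sum_eq_zero h0] at hμ1
      exact zero_ne_one hμ1
    obtain ⟨S, hS, hS0⟩ := hpos
    have hlt' := sum_lt_sum hle ⟨S, hS, mul_lt_mul_of_pos_left (hlt S hS)
      (lt_of_le_of_ne (hμ0 S) hS0.symm)⟩
    rw [← sum_mul, hμ1, one_mul] at hlt'
    simp only [mul_sub, sum_sub_distrib, hcard] at hlt'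
    linarith
  obtain ⟨S, hSW, hS⟩ := hex
  obtain ⟨T, hTS, hT, hST⟩ := exists_subset_card_add_card_filter E hE S
  refine ⟨T, hTS.trans (mem_powerset.mp hSW), hT, hS.trans ?_⟩
  rw [sub_le_iff_le_add]
  exact_mod_cast hST

end Finset

/-! ### Obstructions to identifying codes -/

namespace SimpleGraph

open scoped Finset

section Obstructions

variable {V : Type*} [Fintype V] [DecidableEq V] (G : SimpleGraph V) [DecidableRel G.Adj]

/-- The closed neighbourhood `N[v]` as a finset. -/
def closedNbhdFinset (v : V) : Finset V := insert v (G.neighborFinset v)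

/-- The symmetric difference `N[u] ∆ N[v]` as a finset. -/
def nbhdDiff (u v : V) : Finset V := G.closedNbhdFinset u ∆ G.closedNbhdFinset v

/-- The sets with at least two elements that are a closed neighbourhood, or a difference
`N[u] ∆ N[v]` where `v` is a neighbour of `u` or of `g u`. When `g` selects a neighbour of each
vertex, the latter covers all pairs of false twins. -/
def smallObstructions (g : V → V) : Finset (Finset V) :=
  (Finset.univ.image G.closedNbhdFinset ∪
    (Finset.univ.biUnion (fun u => (G.neighborFinset u).image (G.nbhdDiff u)) ∪
      Finset.univ.biUnion (fun u => (G.neighborFinset (g u)).image (G.nbhdDiff u)))).filter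
    (2 ≤ #·)

/-- The differences `N[u] ∆ N[v]` with at least three elements where `u` and `v` have a common
neighbour. -/
def largeObstructions : Finset (Finset V) :=
  (Finset.univ.biUnion fun u => (G.neighborFinset u).biUnion fun w =>
    (G.neighborFinset w).image (G.nbhdDiff u)).filter (3 ≤ #·)

variable {G}

@[simp]
theorem coe_closedNbhdFinset (v : V) : (G.closedNbhdFinset v : Set V) = G.closedNbhd v := by
  simp [closedNbhdFinset, closedNbhd]

@[simp]
theorem coe_nbhdDiff (u v : V) :
    (G.nbhdDiff u v : Set V) = G.closedNbhd u ∆ G.closedNbhd v := by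
  simp [nbhdDiff, Finset.coe_symmDiff]

theorem mem_closedNbhdFinset {u v : V} :
    u ∈ G.closedNbhdFinset v ↔ u = v ∨ G.Adj v u := by
  simp [closedNbhdFinset]

theorem mem_nbhdDiff {u v w : V} : w ∈ G.nbhdDiff u v ↔
    (w = u ∨ G.Adj u w) ∧ ¬ (w = v ∨ G.Adj v w) ∨
      (w = v ∨ G.Adj v w) ∧ ¬ (w = u ∨ G.Adj u w) := by
  simp only [nbhdDiff, Finset.mem_symmDiff, mem_closedNbhdFinset]

theorem card_image_neighborFinset_le (u v : V) :
    #((G.neighborFinset v).image (G.nbhdDiff u)) ≤ G.maxDegree :=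
  Finset.card_image_le.trans (G.degree_le_maxDegree v)

theorem card_smallObstructions_le (g : V → V) :
    #(G.smallObstructions g) ≤
      Fintype.card V + 2 * (Fintype.card V * G.maxDegree) := by
  have h1 : #(Finset.univ.image G.closedNbhdFinset) ≤ Fintype.card V := Finset.card_image_le
  have h2 := Finset.card_biUnion_le_card_mul Finset.univ
    (fun u => (G.neighborFinset u).image (G.nbhdDiff u)) G.maxDegree
    fun u _ => card_image_neighborFinset_le u u
  have h3 := Finset.card_biUnion_le_card_mul Finset.univ
    (fun u => (G.neighborFinset (g u)).image (G.nbhdDiff u)) G.maxDegree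
    fun u _ => card_image_neighborFinset_le u (g u)
  rw [Finset.card_univ] at h2 h3
  refine (Finset.card_filter_le _ _).trans ((Finset.card_union_le _ _).trans ?_)
  have h4 := Finset.card_union_le
    (Finset.univ.biUnion (fun u => (G.neighborFinset u).image (G.nbhdDiff u)))
    (Finset.univ.biUnion (fun u => (G.neighborFinset (g u)).image (G.nbhdDiff u)))
  omega

theorem card_largeObstructions_le :
    #G.largeObstructions ≤ Fintype.card V * (G.maxDegree * G.maxDegree) := by
  refine (Finset.card_filter_le _ _).trans ?_
  rw [← Finset.card_univ]
  refine Finset.card_biUnion_le_card_mul _ _ _ fun u _ => ?_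
  exact (Finset.card_biUnion_le_card_mul _ _ _ fun w _ =>
    card_image_neighborFinset_le u w).trans
      (Nat.mul_le_mul_right _ (G.degree_le_maxDegree u))

theorem two_le_card_closedNbhdFinset {v w : V} (h : G.Adj v w) :
    2 ≤ #(G.closedNbhdFinset v) :=
  Finset.one_lt_card.mpr ⟨v, mem_closedNbhdFinset.mpr (Or.inl rfl), w,
    mem_closedNbhdFinset.mpr (Or.inr h), h.ne⟩

/-- A difference `N[u] ∆ N[v]` without forced vertices has at least two elements: a singleton
difference `{w}` has `w ≠ u` and `w ≠ v`, because a difference containing one of `u`, `v` contains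
both. -/
theorem IsTwinFree.two_le_card_nbhdDiff (h : G.IsTwinFree) {u v : V} (huv : u ≠ v)
    (hf : ∀ w ∈ G.nbhdDiff u v, ¬ G.IsForcedVertex w) : 2 ≤ #(G.nbhdDiff u v) := by
  by_contra! hlt
  have hne : G.nbhdDiff u v ≠ ∅ := by
    intro h0
    apply h u v huv
    rw [← symmDiff_eq_bot, ← coe_nbhdDiff, h0]
    simp
  have hpos := Finset.card_pos.mpr (Finset.nonempty_iff_ne_empty.mpr hne)
  obtain ⟨w, hw⟩ := Finset.card_eq_one.mp (show #(G.nbhdDiff u v) = 1 by omega)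
  have hall : ∀ x, x ∈ G.nbhdDiff u v ↔ x = w := fun x => by rw [hw, Finset.mem_singleton]
  have hu := hall u
  have hv := hall v
  rw [mem_nbhdDiff] at hu hv
  have hsymm := G.adj_comm u v
  refine hf w ((hall w).mpr rfl) ⟨u, v, huv, ?_, ?_, ?_⟩
  · rintro rfl
    grind
  · rintro rfl
    grind
  · rw [← coe_nbhdDiff, hw, Finset.coe_singleton]

/-- The complement of a set of non-forced vertices that contains no obstruction is an identifying
code. -/
theorem IsTwinFree.isIdentifyingCode_compl (h : G.IsTwinFree) {g : V → V}
    (hg : ∀ v, G.Adj v (g v)) {S : Finset V} (hS : ∀ w ∈ S, ¬ G.IsForcedVertex w)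
    (hsmall : ∀ e ∈ G.smallObstructions g, ¬ e ⊆ S)
    (hlarge : ∀ e ∈ G.largeObstructions, ¬ e ⊆ S) :
    G.IsIdentifyingCode ((S : Set V)ᶜ) := by
  have hclosed : ∀ v, ¬ G.closedNbhdFinset v ⊆ S := fun v => hsmall _ <| by
    refine Finset.mem_filter.mpr ⟨Finset.mem_union_left _ ?_, two_le_card_closedNbhdFinset (hg v)⟩
    exact Finset.mem_image_of_mem _ (Finset.mem_univ v)
  constructor
  · intro v hv
    obtain ⟨c, hc, hcS⟩ := Finset.not_subset.mp (hclosed v)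
    rw [Set.mem_compl_iff, not_not, Finset.mem_coe] at hv
    refine ⟨c, by simpa using hcS, ?_⟩
    rcases mem_closedNbhdFinset.mp hc with rfl | hadj
    · exact absurd hv hcS
    · exact hadj
  · intro u v huv heq
    have hsub : G.nbhdDiff u v ⊆ S := by
      intro x hx
      by_contra hxS
      have hmem := Set.ext_iff.mp heq x
      simp only [Set.mem_inter_iff, Set.mem_compl_iff, Finset.mem_coe, hxS, not_false_eq_true,
        and_true, ← coe_closedNbhdFinset] at hmem
      rw [nbhdDiff, Finset.mem_symmDiff] at hx
      tauto
    have hcard := h.two_le_card_nbhdDiff huv fun w hw => hS w (hsub hw)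
    by_cases hadj : G.Adj u v
    · refine hsmall _ (Finset.mem_filter.mpr ⟨Finset.mem_union_right _ (Finset.mem_union_left _
        ?_), hcard⟩) hsub
      exact Finset.mem_biUnion.mpr ⟨u, Finset.mem_univ u,
        Finset.mem_image_of_mem _ ((G.mem_neighborFinset u v).mpr hadj)⟩
    by_cases hcommon : ∃ w, G.Adj u w ∧ G.Adj w v
    · obtain ⟨w, huw, hwv⟩ := hcommon
      by_cases h3 : 3 ≤ #(G.nbhdDiff u v)
      · refine hlarge _ (Finset.mem_filter.mpr ⟨?_, h3⟩) hsub
        exact Finset.mem_biUnion.mpr ⟨u, Finset.mem_univ u, Finset.mem_biUnion.mpr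
          ⟨w, (G.mem_neighborFinset u w).mpr huw,
            Finset.mem_image_of_mem _ ((G.mem_neighborFinset w v).mpr hwv)⟩⟩
      -- Here `N[u] ∆ N[v] = {u, v}`, so the selected neighbour of `u` is also adjacent to `v`.
      · have hgv : G.Adj (g u) v := by
          by_contra hgv
          have hadj' : ¬ G.Adj v u := fun h' => hadj h'.symm
          have hgv' : ¬ G.Adj v (g u) := fun h' => hgv h'.symm
          have hgu : g u ≠ u := (hg u).ne'
          have hguv : g u ≠ v := fun h' => hadj (h' ▸ hg u)
          refine h3 (Finset.two_lt_card.mpr ⟨u, ?_, v, ?_, g u, ?_, huv, hgu.symm, hguv.symm⟩)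
          · rw [mem_nbhdDiff]; tauto
          · rw [mem_nbhdDiff]; have := huv.symm; tauto
          · rw [mem_nbhdDiff]; have := hg u; tauto
        refine hsmall _ (Finset.mem_filter.mpr ⟨Finset.mem_union_right _
          (Finset.mem_union_right _ ?_), hcard⟩) hsub
        exact Finset.mem_biUnion.mpr ⟨u, Finset.mem_univ u,
          Finset.mem_image_of_mem _ ((G.mem_neighborFinset (g u) v).mpr hgv)⟩
    -- Without a common neighbour, `N[u]` and `N[v]` are disjoint.
    · refine hclosed u (Finset.Subset.trans (fun x hx => ?_) hsub)
      rw [mem_closedNbhdFinset] at hx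
      refine mem_nbhdDiff.mpr (Or.inl ⟨hx, ?_⟩)
      rintro (rfl | hvx)
      · rcases hx with h' | h'
        · exact huv h'.symm
        · exact hadj h'
      · rcases hx with rfl | h'
        · exact hadj hvx.symm
        · exact hcommon ⟨x, h', hvx.symm⟩

end Obstructions

/-! ### The bound on the identifying code number -/

theorem IsIdentifyingCode.idCodeNumber_le {V : Type*} {G : SimpleGraph V} {C : Set V}
    (hC : G.IsIdentifyingCode C) : G.idCodeNumber ≤ C.ncard :=
  Nat.sInf_le ⟨C, hC, rfl⟩

/-- The first-moment bound for a free density `p`. -/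
theorem IsTwinFree.idCodeNumber_le_sub {V : Type*} [Fintype V] {G : SimpleGraph V}
    [DecidableRel G.Adj] (h : G.IsTwinFree) (hiso : ∀ v : V, ∃ w : V, G.Adj v w)
    (p : ℝ) (hp0 : 0 ≤ p) (hp1 : p ≤ 1) :
    (G.idCodeNumber : ℝ) ≤ Fintype.card V - (p * {w : V | ¬ G.IsForcedVertex w}.ncard
      - p ^ 2 * (Fintype.card V + 2 * (Fintype.card V * G.maxDegree))
      - p ^ 3 * (Fintype.card V * (G.maxDegree * G.maxDegree))) := by
  classical
  choose g hg using hiso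
  set W : Finset V := Finset.univ.filter fun w => ¬ G.IsForcedVertex w with hW
  have hWcard : {w : V | ¬ G.IsForcedVertex w}.ncard = #W := by
    rw [← Set.ncard_coe_finset]
    congr 1
    ext w
    simp [hW]
  set E₁ := G.smallObstructions g
  set E₂ := G.largeObstructions
  have hE₁ : ∀ e ∈ E₁, 2 ≤ #e := fun e he => (Finset.mem_filter.mp he).2
  have hE₂ : ∀ e ∈ E₂, 3 ≤ #e := fun e he => (Finset.mem_filter.mp he).2
  obtain ⟨S, hSW, hS, hcard⟩ := Finset.exists_subset_forall_not_subset W (E₁ ∪ E₂)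
    (fun e he => Finset.card_pos.mp <| by
      rcases Finset.mem_union.mp he with he | he
      · exact lt_of_lt_of_le two_pos (hE₁ e he)
      · exact lt_of_lt_of_le three_pos (hE₂ e he)) p hp0 hp1
  have hsum₁ : ∑ e ∈ E₁, p ^ #e ≤
      p ^ 2 * (Fintype.card V + 2 * (Fintype.card V * G.maxDegree)) := by
    refine (Finset.sum_le_card_nsmul E₁ _ (p ^ 2) fun e he =>
      pow_le_pow_of_le_one hp0 hp1 (hE₁ e he)).trans ?_
    rw [nsmul_eq_mul, mul_comm]
    gcongr
    exact_mod_cast card_smallObstructions_le g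
  have hsum₂ : ∑ e ∈ E₂, p ^ #e ≤
      p ^ 3 * (Fintype.card V * (G.maxDegree * G.maxDegree)) := by
    refine (Finset.sum_le_card_nsmul E₂ _ (p ^ 3) fun e he =>
      pow_le_pow_of_le_one hp0 hp1 (hE₂ e he)).trans ?_
    rw [nsmul_eq_mul, mul_comm]
    gcongr
    exact_mod_cast card_largeObstructions_le
  have hunion : ∑ e ∈ E₁ ∪ E₂, p ^ #e ≤ ∑ e ∈ E₁, p ^ #e + ∑ e ∈ E₂, p ^ #e := by
    rw [← Finset.sum_union_inter]
    exact le_add_of_nonneg_right (Finset.sum_nonneg fun e _ => pow_nonneg hp0 _)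
  have hcode := (h.isIdentifyingCode_compl hg (fun w hw => (Finset.mem_filter.mp (hSW hw)).2)
    (fun e he => hS e (Finset.mem_union_left _ he))
    (fun e he => hS e (Finset.mem_union_right _ he))).idCodeNumber_le
  have hcompl : ((S : Set V)ᶜ).ncard + #S = Fintype.card V := by
    rw [← Finset.coe_compl, Set.ncard_coe_finset, Finset.card_compl_add_card]
  have hle : (G.idCodeNumber : ℝ) + #S ≤ Fintype.card V := by
    exact_mod_cast (by omega : G.idCodeNumber + #S ≤ Fintype.card V)
  rw [hWcard]
  linarith

end SimpleGraph

theorem mainTheorem1 {V : Type*} [Fintype V] (G : SimpleGraph V) [DecidableRel G.Adj]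
    (n d : ℕ) (hn : Fintype.card V = n) (hd : G.maxDegree = d) (hd3 : 3 ≤ d)
    (htwin : G.IsTwinFree) (hiso : ∀ v : V, ∃ w : V, G.Adj v w) :
    (G.idCodeNumber : ℝ) ≤ (n : ℝ) - (n : ℝ) * G.nonForcedProportion ^ 2 / (103 * (d : ℝ)) := by
  have hdR : (3 : ℝ) ≤ d := by exact_mod_cast hd3
  have hd0 : (0 : ℝ) < d := by linarith
  have hn0 : 0 < n := by
    rw [← hn, Fintype.card_pos_iff]
    by_contra hempty
    rw [not_nonempty_iff] at hempty
    have := G.maxDegree_of_subsingleton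
    omega
  have hnR : (0 : ℝ) < n := by exact_mod_cast hn0
  set f := G.nonForcedProportion with hf
  have hfn : ({w : V | ¬ G.IsForcedVertex w}.ncard : ℝ) = f * n := by
    rw [hf, SimpleGraph.nonForcedProportion, Nat.card_eq_fintype_card, hn,
      div_mul_cancel₀ _ hnR.ne']
  have hf0 : 0 ≤ f := div_nonneg (Nat.cast_nonneg _) (Nat.cast_nonneg _)
  have hf1 : f ≤ 1 := by
    refine div_le_one_of_le₀ ?_ (Nat.cast_nonneg _)
    exact_mod_cast Set.ncard_le_card _
  have hp1 : f / (4 * d) ≤ 1 := by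
    rw [div_le_one (by positivity)]
    linarith
  have hmain := htwin.idCodeNumber_le_sub hiso (f / (4 * d)) (by positivity) hp1
  rw [hfn, hn, hd] at hmain
  refine hmain.trans (sub_le_sub_left ?_ _)
  have hid : f / (4 * d) * (f * n) - (f / (4 * d)) ^ 2 * (n + 2 * (n * d))
      - (f / (4 * d)) ^ 3 * (n * (d * d)) =
      n * f ^ 2 / d * (1 / 4 - (1 / d + 2) / 16 - f / 64) := by
    field_simp
    ring
  have hinv : 1 / (d : ℝ) ≤ 1 / 3 := one_div_le_one_div_of_le (by norm_num) hdR
  rw [hid, show (n : ℝ) * f ^ 2 / (103 * d) = n * f ^ 2 / d * (1 / 103) by field_simp]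
  refine mul_le_mul_of_nonneg_left ?_ (by positivity)
  linarith
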